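/- Let $p\in[\tfrac12,1)$, $q:=1-p$, and let $(S_n)_{n\ge 0}$ be a random walk on $\mathbb{Z}$ with $S_0=0$ and mutually independent increments $X_n:=S_n-S_{n-1}\in\{+1,-1\}$, $n\ge 1$, with $\mathrm{P}[X_n=+1]=p$ and $\mathrm{P}[X_n=-1]=q$. Let $R_n:=\#\{1\le k\le n: X_k=+1\}$ and, for a positive integer $d$, let $N_d:=\inf\{n\ge 0: S_n=d\}$. Then $N_d$ is almost surely finite, $R_{N_d}/N_d$ is integrable, and $$ \mathrm{E}\left[\frac{R_{N_d}}{N_d}\right] =(-1)^{(d-1)/2}\, d\left(\frac pq\right)^{d/2}\arctan\left(\sqrt{\frac qp}\right)+1-d\sum_{k=0}^{(d-1)/2}\frac{(-1)^k}{d-2k}\left(\frac pq\right)^k $$ if $d$ is odd, while $$ \mathrm{E}\left[\frac{R_{N_d}}{N_d}\right] =(-1)^{d/2}\,\frac d2\left(\frac pq\right)^{d/2}\ln p+1-\frac d2\left(\frac pq\right)^{d/2}\sum_{k=1}^{d/2}(-1)^{(d/2)+k}\binom{d/2}{k}\frac{p^{-k}-1}{k} $$ if $d$ is even. In particular, for $p=\tfrac12$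 the expectation equals $\pi/4$ for $d=1$, $\ln 2$ for $d=2$, and $3(1-\pi/4)$ for $d=3$. -/

import Mathlib

open MeasureTheory ProbabilityTheory

noncomputable section

namespace WinRate

variable {Ω : Type*}

/-- The `(n + 1)`-st step `X_{n+1} = S_{n+1} - S_n` of an integer-valued process `S`. -/
def step (S : ℕ → Ω → ℤ) (n : ℕ) (ω : Ω) : ℤ := S (n + 1) ω - S n ω

/-- `S` is, under `μ`, a simple random walk on `ℤ` started at `0`, with mutually independent
steps equal to `+1` with probability `p` and to `-1` with probability `1 - p`. -/
structure IsSimpleRandomWalk [MeasurableSpace Ω] (μ : Measure Ω) (p : ℝ) (S : ℕ → Ω → ℤ) :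
    Prop where
  measurable : ∀ n, Measurable (S n)
  zero : ∀ ω, S 0 ω = 0
  indep : iIndepFun (step S) μ
  prob_right : ∀ n, μ.real {ω | step S n ω = 1} = p
  prob_left : ∀ n, μ.real {ω | step S n ω = -1} = 1 - p

/-- `R_n`, the number of right steps ("wins") among the first `n` steps. -/
def wins (S : ℕ → Ω → ℤ) (n : ℕ) (ω : Ω) : ℕ :=
  ((Finset.range n).filter (fun k => step S k ω = 1)).card

/-- `N_d = inf {n ≥ 0 : S_n = d}`, with value `⊤` if the walk never visits `d`. -/
def hitTime (S : ℕ → Ω → ℤ) (d : ℕ) : Ω → WithTop ℕ :=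
  hittingAfter S {(d : ℤ)} 0

/-- The win rate `R_{N_d} / N_d` at the hitting time (with the conventional value `0` on the
event `N_d = ⊤`). -/
def winRate (S : ℕ → Ω → ℤ) (d : ℕ) (ω : Ω) : ℝ :=
  (wins S ((hitTime S d ω).untopD 0) ω : ℝ) / ((hitTime S d ω).untopD 0 : ℕ)

end WinRate

end

/-! Write N for `N_d`. Since `S_N = 2 R_N - N = d`, the win rate is `1/2 + d/(2N)`, so everything
reduces to `E[1/N]`. Put `s(u) = u/(p + q u²)`. Then `s(u)^n u^(-S_n)` is a martingale. Stopped at N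
it is bounded by `u^(-d)`, and optional stopping gives `E[s(u)^N; N < ∞] = u^d` for `0 < u < 1`
(`integral_indicator_pow_hitTime`). The condition `p ≥ 1/2` ensures `s(u) < 1` there; letting `u →
1` shows that N is almost surely finite. As `s(0) = 0` and `s(1) = 1`, one has `1/n = ∫₀¹ s^(n-1) s'
du`. Fubini then gives `E[1/N] = ∫₀¹ u^d s'/s du`, and the expected win rate is `d p ∫₀¹ u^(d-1)/(p
+ q u²) du` (`integral_winRate`). A two-step recursion in the exponent evaluates this integral,
starting from an arctangent for odd `d` and a logarithm for even `d`. -/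

noncomputable section

namespace WinRate

/-! ### Binomial sums for the even case -/

/-- The alternating sum `∑ (-1)^(m+k) C(m,k) (x^k - 1) / k`, over `1 ≤ k ≤ m`. -/
def alternatingSum (x : ℝ) (m : ℕ) : ℝ :=
  ∑ k ∈ Finset.Icc 1 m, (-1) ^ (m + k) * (m.choose k : ℝ) * ((x ^ k - 1) / k)

lemma alternatingSum_eq_range (x : ℝ) (m : ℕ) {N : ℕ} (hN : m ≤ N) :
    alternatingSum x m =
      ∑ k ∈ Finset.range N, (-1) ^ (m + (k + 1)) * (m.choose (k + 1) : ℝ) *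
        ((x ^ (k + 1) - 1) / ((k : ℝ) + 1)) := by
  have h : alternatingSum x m = ∑ k ∈ Finset.range m, (-1) ^ (m + (k + 1)) *
      (m.choose (k + 1) : ℝ) * ((x ^ (k + 1) - 1) / ((k : ℝ) + 1)) := by
    rw [alternatingSum, Finset.range_eq_Ico, ← Finset.Ico_succ_right_eq_Icc,
      Finset.sum_Ico_eq_sum_range, Finset.range_eq_Ico]
    simp [add_comm]
  rw [h]
  refine Finset.sum_subset (Finset.range_mono hN) fun k _ hk => ?_
  rw [Nat.choose_eq_zero_of_lt (by simpa using hk)]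
  simp

/-- By Pascal's rule and absorption, the terms combine into the binomial expansion of `(x -
1)^(m+1)` minus that of `(1 - 1)^(m+1)`. With `x = 1/p`, where `x - 1 = q/p`, this matches the
recursion of the odd-exponent integrals. -/
lemma alternatingSum_succ (x : ℝ) (m : ℕ) :
    alternatingSum x (m + 1) + alternatingSum x m = (x - 1) ^ (m + 1) / (m + 1) := by
  have key : ∀ y : ℝ, (y - 1) ^ (m + 1) - (-1) ^ (m + 1) =
      ∑ k ∈ Finset.range (m + 1), y ^ (k + 1) * (-1) ^ (m - k) * ((m + 1).choose (k + 1) : ℝ) := by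
    intro y
    rw [sub_eq_add_neg y 1, add_pow, Finset.sum_range_succ']
    simp
  have h1 : (x - 1) ^ (m + 1) = ((x - 1) ^ (m + 1) - (-1) ^ (m + 1)) -
      ((1 - 1) ^ (m + 1) - (-1) ^ (m + 1)) := by simp
  rw [h1, key x, key 1, alternatingSum_eq_range x (m + 1) le_rfl,
    alternatingSum_eq_range x m (Nat.le_succ m), ← Finset.sum_add_distrib,
    ← Finset.sum_sub_distrib, Finset.sum_div]
  refine Finset.sum_congr rfl fun k hk => ?_
  have hk : k ≤ m := by simpa [Nat.lt_succ_iff] using hk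
  have hs : (-1 : ℝ) ^ (m - k) = (-1) ^ (m + k) := by
    rw [show m + k = (m - k) + 2 * k by omega, pow_add, pow_mul]; simp
  have hc : ((m + 1).choose (k + 1) : ℝ) * (k + 1) = (m + 1) * m.choose k := by
    exact_mod_cast (Nat.add_one_mul_choose_eq m k).symm
  have hp : ((m + 1).choose (k + 1) : ℝ) = m.choose k + m.choose (k + 1) := by
    exact_mod_cast Nat.choose_succ_succ m k
  have hk0 : (k : ℝ) + 1 ≠ 0 := by positivity
  have hm0 : (m : ℝ) + 1 ≠ 0 := by positivity
  rw [hs, one_pow]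
  have e1 : (-1 : ℝ) ^ (m + 1 + (k + 1)) = (-1) ^ (m + k) := by ring
  have e2 : (-1 : ℝ) ^ (m + (k + 1)) = -(-1) ^ (m + k) := by ring
  rw [e1, e2]
  have hc' : (m.choose k : ℝ) = ((m + 1).choose (k + 1) : ℝ) * (k + 1) / (m + 1) := by
    field_simp; linarith
  have hp' : (m.choose (k + 1) : ℝ) = ((m + 1).choose (k + 1) : ℝ) - m.choose k := by linarith
  rw [hp', hc']
  field_simp
  ring

/-! ### The ratio integrals and their closed forms -/

/-- The integral `∫₀¹ u^n / (p + q u²) du`. -/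
def ratioIntegral (p q : ℝ) (n : ℕ) : ℝ := ∫ u in (0 : ℝ)..1, u ^ n / (p + q * u ^ 2)

section

variable {p q : ℝ} (hp : 0 < p) (hq : 0 < q)
include hp hq

lemma denom_pos (u : ℝ) : 0 < p + q * u ^ 2 := by positivity

lemma continuous_ratio (n : ℕ) : Continuous fun u : ℝ => u ^ n / (p + q * u ^ 2) :=
  Continuous.div (by fun_prop) (by fun_prop) fun u => (denom_pos hp hq u).ne'

/-- The numerators add up to `u^n (p + q u²)`, which cancels the denominator. -/
lemma ratioIntegral_add_two (n : ℕ) :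
    q * ratioIntegral p q (n + 2) + p * ratioIntegral p q n = 1 / (n + 1) := by
  have h1 := (continuous_ratio hp hq (n + 2)).intervalIntegrable (μ := volume) 0 1
  have h2 := (continuous_ratio hp hq n).intervalIntegrable (μ := volume) 0 1
  rw [ratioIntegral, ratioIntegral, ← intervalIntegral.integral_const_mul,
    ← intervalIntegral.integral_const_mul,
    ← intervalIntegral.integral_add (h1.const_mul q) (h2.const_mul p)]
  have : (fun u : ℝ => q * (u ^ (n + 2) / (p + q * u ^ 2)) + p * (u ^ n / (p + q * u ^ 2)))
      = fun u => u ^ n := by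
    ext u
    have := (denom_pos hp hq u).ne'
    field_simp
    ring
  rw [this, integral_pow]
  simp

lemma ratioIntegral_zero :
    p * ratioIntegral p q 0 = Real.sqrt (p / q) * Real.arctan (Real.sqrt (q / p)) := by
  set c := Real.sqrt (q / p) with hc
  have hc0 : 0 < c := Real.sqrt_pos.2 (by positivity)
  have hc2 : c ^ 2 = q / p := Real.sq_sqrt (by positivity)
  have hinv : Real.sqrt (p / q) = c⁻¹ := by rw [hc, ← Real.sqrt_inv, inv_div]
  have hI : ratioIntegral p q 0 =
      Real.arctan (c * 1) * (c * p)⁻¹ - Real.arctan (c * 0) * (c * p)⁻¹ := by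
    refine intervalIntegral.integral_eq_sub_of_hasDerivAt
      (f := fun u => Real.arctan (c * u) * (c * p)⁻¹) (fun u _ => ?_)
      ((continuous_ratio hp hq 0).intervalIntegrable _ _)
    have h := (((hasDerivAt_id u).const_mul c).arctan).mul_const ((c * p)⁻¹)
    refine h.congr_deriv ?_
    have : 1 + (c * u) ^ 2 = (p + q * u ^ 2) / p := by
      rw [mul_pow, hc2]; field_simp
    have h' := (denom_pos hp hq u).ne'
    rw [id_eq, this]
    field_simp
  rw [hI, hinv]
  simp
  field_simp

lemma ratioIntegral_one (hpq : p + q = 1) : 2 * q * ratioIntegral p q 1 = -Real.log p := by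
  have hI : ratioIntegral p q 1 = Real.log (p + q * 1 ^ 2) * (2 * q)⁻¹ -
      Real.log (p + q * 0 ^ 2) * (2 * q)⁻¹ := by
    refine intervalIntegral.integral_eq_sub_of_hasDerivAt
      (f := fun u => Real.log (p + q * u ^ 2) * (2 * q)⁻¹) (fun u _ => ?_)
      ((continuous_ratio hp hq 1).intervalIntegrable _ _)
    have h := (((((hasDerivAt_id u).pow 2).const_mul q).const_add p).log
      (denom_pos hp hq u).ne').mul_const ((2 * q)⁻¹)
    refine h.congr_deriv ?_
    have h' := (denom_pos hp hq u).ne'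
    simp
    field_simp
  rw [hI]
  simp [hpq]
  field_simp

lemma ratioIntegral_even (m : ℕ) :
    (2 * m + 1) * p * ratioIntegral p q (2 * m) =
      (-1) ^ m * (2 * m + 1) * ((p / q) ^ m * Real.sqrt (p / q)) *
        Real.arctan (Real.sqrt (q / p)) + 1 -
      (2 * m + 1) * ∑ k ∈ Finset.range (m + 1), (-1) ^ k / (2 * (m : ℝ) + 1 - 2 * k) *
        (p / q) ^ k := by
  induction m with
  | zero => simpa using ratioIntegral_zero hp hq
  | succ m ih =>
    have hrec := ratioIntegral_add_two hp hq (2 * m)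
    have hm : (2 * m + 1 : ℝ) ≠ 0 := by positivity
    have hm' : (2 * (m + 1) + 1 : ℝ) ≠ 0 := by positivity
    rw [Finset.sum_range_succ']
    have hsum : ∑ k ∈ Finset.range (m + 1), (-1 : ℝ) ^ (k + 1) /
        (2 * ((m + 1 : ℕ) : ℝ) + 1 - 2 * ((k + 1 : ℕ) : ℝ)) * (p / q) ^ (k + 1) =
        -(p / q) * ∑ k ∈ Finset.range (m + 1), (-1) ^ k / (2 * (m : ℝ) + 1 - 2 * k) *
          (p / q) ^ k := by
      rw [Finset.mul_sum]
      refine Finset.sum_congr rfl fun k _ => ?_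
      rw [show 2 * ((m + 1 : ℕ) : ℝ) + 1 - 2 * ((k + 1 : ℕ) : ℝ) = 2 * (m : ℝ) + 1 - 2 * k by
        push_cast; ring]
      ring
    rw [hsum]
    set T := ∑ k ∈ Finset.range (m + 1), (-1) ^ k / (2 * (m : ℝ) + 1 - 2 * k) * (p / q) ^ k
    have h1 : ratioIntegral p q (2 * (m + 1)) =
        (1 / (2 * m + 1) - p * ratioIntegral p q (2 * m)) / q := by
      rw [eq_div_iff hq.ne']
      push_cast at hrec
      rw [← hrec, mul_add]
      ring
    have h2 : p * ratioIntegral p q (2 * m) =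
        (-1) ^ m * ((p / q) ^ m * Real.sqrt (p / q)) * Real.arctan (Real.sqrt (q / p)) +
          1 / (2 * m + 1) - T := by
      field_simp
      linear_combination ih
    -- The `k = 0` term, times `2m + 3`, cancels the isolated `1` of the closed form; the other
    -- terms are `-(p/q)` times the previous sum.
    have h0 : (-1 : ℝ) ^ 0 / (2 * ((m + 1 : ℕ) : ℝ) + 1 - 2 * ((0 : ℕ) : ℝ)) * (p / q) ^ 0 =
        1 / (2 * (m + 1) + 1) := by
      push_cast; simp
    rw [h1, h2, h0, pow_succ (p / q) m]
    generalize (p / q) ^ m = P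
    generalize Real.sqrt (p / q) = Q, Real.arctan (Real.sqrt (q / p)) = R
    push_cast
    field_simp
    ring

lemma ratioIntegral_odd (hpq : p + q = 1) (m : ℕ) :
    (2 * m + 2) * p * ratioIntegral p q (2 * m + 1) =
      (-1) ^ (m + 1) * (m + 1) * (p / q) ^ (m + 1) * Real.log p + 1 -
      (m + 1) * (p / q) ^ (m + 1) * alternatingSum p⁻¹ (m + 1) := by
  have hr : (p⁻¹ - 1) = q / p := by field_simp; linarith
  induction m with
  | zero =>
    have h := ratioIntegral_one hp hq hpq
    have hs : alternatingSum p⁻¹ 1 = q / p := by simp [alternatingSum, hr]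
    rw [zero_add, hs]
    have h1 : ratioIntegral p q 1 = -Real.log p / (2 * q) := by
      field_simp; linarith
    simp [h1]
    field_simp
    ring
  | succ m ih =>
    have hrec := ratioIntegral_add_two hp hq (2 * m + 1)
    have hs := alternatingSum_succ p⁻¹ (m + 1)
    rw [hr] at hs
    have hm : (m + 1 : ℝ) ≠ 0 := by positivity
    have hm' : (m + 1 + 1 : ℝ) ≠ 0 := by positivity
    have h1 : ratioIntegral p q (2 * (m + 1) + 1) =
        (1 / (2 * m + 2) - p * ratioIntegral p q (2 * m + 1)) / q := by
      rw [eq_div_iff hq.ne']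
      push_cast at hrec
      rw [show (2 * m + 2 : ℝ) = 2 * m + 1 + 1 by ring, ← hrec,
        show 2 * (m + 1) + 1 = 2 * m + 1 + 2 by ring]
      ring
    have h2 : p * ratioIntegral p q (2 * m + 1) = ((-1) ^ (m + 1) * (m + 1) *
        (p / q) ^ (m + 1) * Real.log p + 1 -
        (m + 1) * (p / q) ^ (m + 1) * alternatingSum p⁻¹ (m + 1)) / (2 * m + 2) := by
      rw [← ih]; field_simp
    have h3 : alternatingSum p⁻¹ (m + 1 + 1) =
        (q / p) ^ (m + 1 + 1) / (((m + 1 : ℕ) : ℝ) + 1) - alternatingSum p⁻¹ (m + 1) := by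
      linarith
    have h4 : (p / q) ^ (m + 1 + 1) * (q / p) ^ (m + 1 + 1) = 1 := by
      rw [← mul_pow, show p / q * (q / p) = 1 by field_simp, one_pow]
    rw [h1, h3]
    set A := alternatingSum p⁻¹ (m + 1)
    -- The inhomogeneous term of `alternatingSum_succ` contributes exactly `1`, which again cancels
    -- the isolated `1`.
    have h5 : (((m + 1 : ℕ) : ℝ) + 1) * (p / q) ^ (m + 1 + 1) *
        ((q / p) ^ (m + 1 + 1) / (((m + 1 : ℕ) : ℝ) + 1) - A) =
        1 - (((m + 1 : ℕ) : ℝ) + 1) * (p / q) ^ (m + 1 + 1) * A := by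
      have : (((m + 1 : ℕ) : ℝ) + 1) ≠ 0 := by positivity
      rw [← h4]
      field_simp
    rw [h5, h2, pow_succ (p / q) (m + 1)]
    generalize (p / q) ^ (m + 1) = P
    push_cast
    field_simp
    ring

end

lemma odd_formula {p q : ℝ} (hp : 0 < p) (hq : 0 < q) {d : ℕ} (hd : Odd d) :
    d * p * ratioIntegral p q (d - 1) =
      (-1) ^ ((d - 1) / 2) * d * (p / q) ^ ((d : ℝ) / 2) * Real.arctan (Real.sqrt (q / p))
        + 1 - d * ∑ k ∈ Finset.range ((d - 1) / 2 + 1),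
              (-1) ^ k / ((d : ℝ) - 2 * k) * (p / q) ^ k := by
  obtain ⟨m, rfl⟩ := hd
  have h := ratioIntegral_even hp hq m
  have hpow : (p / q) ^ (((2 * m + 1 : ℕ) : ℝ) / 2) = (p / q) ^ m * Real.sqrt (p / q) := by
    rw [show ((2 * m + 1 : ℕ) : ℝ) / 2 = (m : ℝ) + 1 / 2 by push_cast; ring,
      Real.rpow_add (by positivity), Real.rpow_natCast, Real.sqrt_eq_rpow]
  rw [hpow, Nat.add_sub_cancel, Nat.mul_div_cancel_left m two_pos]
  push_cast
  exact h

lemma even_formula {p q : ℝ} (hp : 0 < p) (hq : 0 < q) (hpq : p + q = 1) {d : ℕ} (hd0 : 0 < d)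
    (hd : Even d) :
    d * p * ratioIntegral p q (d - 1) =
      (-1) ^ (d / 2) * ((d : ℝ) / 2) * (p / q) ^ (d / 2) * Real.log p + 1
          - (d : ℝ) / 2 * (p / q) ^ (d / 2) *
            ∑ k ∈ Finset.Icc 1 (d / 2),
              (-1) ^ (d / 2 + k) * ((d / 2).choose k : ℝ) * (((p ^ k)⁻¹ - 1) / k) := by
  obtain ⟨m, rfl⟩ := hd
  obtain ⟨m, rfl⟩ : ∃ n, m = n + 1 := ⟨m - 1, by omega⟩
  have h := ratioIntegral_odd hp hq hpq m
  rw [show (m + 1 + (m + 1)) / 2 = m + 1 by omega,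
    show m + 1 + (m + 1) - 1 = 2 * m + 1 by omega,
    show ((m + 1 + (m + 1) : ℕ) : ℝ) = 2 * m + 2 by push_cast; ring, h]
  simp only [alternatingSum, inv_pow]
  rw [show (2 * m + 2 : ℝ) / 2 = m + 1 by ring]

end WinRate

end
-- Pathwise facts: hitting time and stopped exponential
noncomputable section

namespace WinRate

section Path

variable {Ω : Type*} {S : ℕ → Ω → ℤ} {ω : Ω} {d : ℕ}

lemma add_step (S : ℕ → Ω → ℤ) (n : ℕ) (ω : Ω) : S (n + 1) ω = S n ω + step S n ω := by
  simp [step]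

lemma hitTime_eq_top_iff : hitTime S d ω = ⊤ ↔ ∀ j, S j ω ≠ d := by
  simp [hitTime, hittingAfter_eq_top_iff]

lemma hitTime_eq_coe_iff {n : ℕ} :
    hitTime S d ω = WithTop.some n ↔ S n ω = d ∧ ∀ j < n, S j ω ≠ d := by
  constructor
  · intro h
    refine ⟨?_, fun j hj => ?_⟩
    · have := hittingAfter_mem_set_of_ne_top (u := S) (s := {(d : ℤ)}) (n := 0) (ω := ω)
        (by rw [hitTime] at h; simp [h])
      rw [hitTime] at h
      rw [h] at this
      exact Set.mem_singleton_iff.1 this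
    · have := notMem_of_lt_hittingAfter (u := S) (s := {(d : ℤ)}) (n := 0) (ω := ω) (k := j)
        (by rw [hitTime] at h; rw [h]; exact WithTop.coe_lt_coe.2 hj) (Nat.zero_le j)
      simpa using this
  · rintro ⟨h1, h2⟩
    refine le_antisymm (hittingAfter_le_of_mem (Nat.zero_le n) (by simpa using h1)) ?_
    by_contra! hlt
    have hlt' := hlt
    rw [hitTime] at hlt
    lift hittingAfter S {(d : ℤ)} 0 ω to ℕ using hlt.ne_top with m hm
    have := hittingAfter_mem_set_of_ne_top (u := S) (s := {(d : ℤ)}) (n := 0) (ω := ω)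
      (by simp [← hm])
    rw [← hm] at this
    exact h2 m (WithTop.coe_lt_coe.1 hlt) (Set.mem_singleton_iff.1 this)

lemma step_sum (h0 : S 0 ω = 0) (n : ℕ) : S n ω = ∑ k ∈ Finset.range n, step S k ω := by
  rw [← sub_zero (S n ω), ← h0, ← Finset.sum_range_sub (fun k => S k ω)]
  rfl

/-- At the hitting time this makes the win rate a function of `N_d` alone. -/
lemma eq_two_mul_wins_sub (h0 : S 0 ω = 0) (hstep : ∀ n, step S n ω = 1 ∨ step S n ω = -1)
    (n : ℕ) : S n ω = 2 * (wins S n ω : ℤ) - n := by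
  induction n with
  | zero => simp [wins, h0]
  | succ n ih =>
    have hw : (wins S (n + 1) ω : ℤ) = wins S n ω + if step S n ω = 1 then 1 else 0 := by
      rw [wins, wins, Finset.range_add_one, Finset.filter_insert]
      split_ifs <;> simp
    rw [add_step S, ih, hw]
    rcases hstep n with h | h <;> simp [h] <;> ring

/-- Steps of size one cannot jump over `d`. -/
lemma lt_of_forall_ne (hd : 0 < d) (h0 : S 0 ω = 0)
    (hstep : ∀ n, step S n ω = 1 ∨ step S n ω = -1) {n : ℕ} (h : ∀ j ≤ n, S j ω ≠ d) :
    S n ω < d := by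
  induction n with
  | zero => simpa [h0] using hd
  | succ n ih =>
    have h1 := ih fun j hj => h j (by omega)
    have h2 := h (n + 1) le_rfl
    have h3 := add_step S n ω
    rcases hstep n with h4 | h4 <;> omega

/-- The exponential functional `s^n u^(-S_n)`, killed at the first visit to `d`. -/
def killedExp (S : ℕ → Ω → ℤ) (d : ℕ) (u s : ℝ) (n : ℕ) (ω : Ω) : ℝ :=
  open Classical in if ∀ j ≤ n, S j ω ≠ d then s ^ n * u ^ (-(S n ω)) else 0

/-- The exponential functional `s^n u^(-S_n)`, stopped at the first visit to `d`, as the sum of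
its increments. -/
def stoppedExp (S : ℕ → Ω → ℤ) (d : ℕ) (u s : ℝ) (n : ℕ) (ω : Ω) : ℝ :=
  1 + ∑ k ∈ Finset.range n, killedExp S d u s k ω * (s * u ^ (-(step S k ω)) - 1)

variable {u s : ℝ}

/-- The increments telescope. Only times `j < n` are constrained, so `n = N_d` itself is covered. -/
lemma stoppedExp_of_forall_ne (h0 : S 0 ω = 0) (hu : u ≠ 0) {n : ℕ}
    (h : ∀ j < n, S j ω ≠ d) : stoppedExp S d u s n ω = s ^ n * u ^ (-(S n ω)) := by
  induction n with
  | zero => simp [stoppedExp, h0]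
  | succ n ih =>
    have hk : killedExp S d u s n ω = s ^ n * u ^ (-(S n ω)) :=
      if_pos fun j hj => h j (by omega)
    have hs : stoppedExp S d u s (n + 1) ω =
        stoppedExp S d u s n ω + killedExp S d u s n ω * (s * u ^ (-(step S n ω)) - 1) := by
      simp only [stoppedExp, Finset.sum_range_succ]; ring
    rw [hs, ih fun j hj => h j (by omega), hk, add_step S, neg_add, zpow_add₀ hu]
    ring

lemma stoppedExp_of_le {N n : ℕ} (hN : S N ω = d) (hn : N ≤ n) :
    stoppedExp S d u s n ω = stoppedExp S d u s N ω := by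
  induction n, hn using Nat.le_induction with
  | base => rfl
  | succ n hn ih =>
    have hk : killedExp S d u s n ω = 0 := if_neg fun h => h N hn hN
    rw [← ih]
    simp [stoppedExp, Finset.sum_range_succ, hk]

lemma zpow_neg_le (hu0 : 0 < u) (hu1 : u ≤ 1) {x : ℤ} (hx : x ≤ d) :
    u ^ (-x) ≤ (u ^ d)⁻¹ := by
  rw [← zpow_natCast, ← zpow_neg]
  exact zpow_le_zpow_right_of_le_one₀ hu0 hu1 (by omega)

section Bounds

variable (hd : 0 < d) (h0 : S 0 ω = 0) (hstep : ∀ n, step S n ω = 1 ∨ step S n ω = -1)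
  (hu0 : 0 < u) (hu1 : u ≤ 1) (hs0 : 0 ≤ s) (hs1 : s ≤ 1)
include hd h0 hstep hu0 hu1 hs0 hs1

lemma abs_killedExp_le (n : ℕ) : |killedExp S d u s n ω| ≤ (u ^ d)⁻¹ := by
  rw [killedExp]
  split_ifs with h
  · rw [abs_of_nonneg (by positivity)]
    have h1 := zpow_neg_le hu0 hu1 (lt_of_forall_ne hd h0 hstep h).le
    calc s ^ n * u ^ (-(S n ω)) ≤ 1 * (u ^ d)⁻¹ := by
          gcongr
          exact pow_le_one₀ hs0 hs1
      _ = _ := one_mul _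
  · simp; positivity

lemma abs_increment_le (n : ℕ) :
    |killedExp S d u s n ω * (s * u ^ (-(step S n ω)) - 1)| ≤ (u ^ d)⁻¹ * (u⁻¹ + 1) := by
  rw [abs_mul]
  refine mul_le_mul (abs_killedExp_le hd h0 hstep hu0 hu1 hs0 hs1 n) ?_ (abs_nonneg _)
    (by positivity)
  have hx : u ^ (-(step S n ω)) ≤ u⁻¹ := by
    have h := zpow_neg_le (d := 1) hu0 hu1 (x := step S n ω)
      (by rcases hstep n with h | h <;> simp [h])
    simpa using h
  have hx0 : 0 < u ^ (-(step S n ω)) := by positivity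
  have : s * u ^ (-(step S n ω)) ≤ 1 * u⁻¹ := by gcongr
  have h1 : 0 ≤ s * u ^ (-(step S n ω)) := by positivity
  have h2 : 0 < u⁻¹ := by positivity
  rw [abs_le]
  constructor <;> linarith

/-- Up to the hitting time the walk stays at or below `d`, and afterwards the process is frozen. The
bound is uniform in `n` and serves as the dominating constant in optional stopping. -/
lemma abs_stoppedExp_le (n : ℕ) : |stoppedExp S d u s n ω| ≤ (u ^ d)⁻¹ := by
  have key : ∀ m, (∀ j < m, S j ω ≠ d) → |stoppedExp S d u s m ω| ≤ (u ^ d)⁻¹ := by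
    intro m hm
    rw [stoppedExp_of_forall_ne h0 hu0.ne' hm, abs_of_nonneg (by positivity)]
    have hle : S m ω ≤ d := by
      rcases m with _ | m
      · simp [h0]
      · have h1 := lt_of_forall_ne hd h0 hstep (n := m) fun j hj => hm j (by omega)
        have h3 := add_step S m ω
        rcases hstep m with h4 | h4 <;> omega
    calc s ^ m * u ^ (-(S m ω)) ≤ 1 * (u ^ d)⁻¹ := by
          gcongr
          · exact pow_le_one₀ hs0 hs1
          · exact zpow_neg_le hu0 hu1 hle
      _ = _ := one_mul _
  by_cases h : ∀ j < n, S j ω ≠ d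
  · exact key n h
  · push Not at h
    classical
    have hex : ∃ j, S j ω = d := ⟨h.choose, h.choose_spec.2⟩
    have hle : Nat.find hex ≤ n := by
      obtain ⟨j, hj, hjd⟩ := h
      exact (Nat.find_min' hex hjd).trans hj.le
    rw [stoppedExp_of_le (Nat.find_spec hex) hle]
    exact key _ fun j hj => Nat.find_min hex hj

end Bounds

-- If `d` is never hit, `u^(-S_n)` stays bounded and `s^n → 0`; this is where `s < 1` must be
-- strict. Otherwise the sequence is eventually constant.
open Filter Topology in
lemma tendsto_stoppedExp (hd : 0 < d) (h0 : S 0 ω = 0)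
    (hstep : ∀ n, step S n ω = 1 ∨ step S n ω = -1)
    (hu0 : 0 < u) (hu1 : u ≤ 1) (hs0 : 0 ≤ s) (hs1 : s < 1) :
    Tendsto (fun n => stoppedExp S d u s n ω) atTop
      (𝓝 ({ω | hitTime S d ω ≠ ⊤}.indicator
        (fun ω => s ^ (hitTime S d ω).untopD 0 * (u ^ d)⁻¹) ω)) := by
  by_cases h : hitTime S d ω = ⊤
  · rw [Set.indicator_of_notMem (by simpa using h)]
    rw [hitTime_eq_top_iff] at h
    have hlim : Tendsto (fun n => s ^ n * (u ^ d)⁻¹) atTop (𝓝 0) := by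
      simpa using (tendsto_pow_atTop_nhds_zero_of_lt_one hs0 hs1).mul_const ((u ^ d)⁻¹)
    refine squeeze_zero (fun n => ?_) (fun n => ?_) hlim
    · rw [stoppedExp_of_forall_ne h0 hu0.ne' fun j _ => h j]; positivity
    · rw [stoppedExp_of_forall_ne h0 hu0.ne' fun j _ => h j]
      have := zpow_neg_le hu0 hu1 (lt_of_forall_ne hd h0 hstep (n := n) fun j _ => h j).le
      gcongr
  · rw [Set.indicator_of_mem (by simpa using h)]
    obtain ⟨N, hN⟩ := WithTop.ne_top_iff_exists.1 h
    obtain ⟨h1, h2⟩ := hitTime_eq_coe_iff.1 hN.symm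
    rw [← hN]
    refine tendsto_const_nhds.congr' ?_
    filter_upwards [eventually_ge_atTop N] with n hn
    rw [stoppedExp_of_le h1 hn, stoppedExp_of_forall_ne h0 hu0.ne' h2, h1,
      show (WithTop.some N).untopD 0 = N from rfl]
    simp

end Path

/-! ### Optional stopping and the generating function of the hitting time -/

namespace IsSimpleRandomWalk

variable {Ω : Type*} [MeasurableSpace Ω] {μ : Measure Ω} [IsProbabilityMeasure μ] {p : ℝ}
  {S : ℕ → Ω → ℤ} (hS : IsSimpleRandomWalk μ p S)
include hS

omit [IsProbabilityMeasure μ] in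
lemma measurable_step (n : ℕ) : Measurable (step S n) :=
  (hS.measurable (n + 1)).sub (hS.measurable n)

lemma ae_step : ∀ᵐ ω ∂μ, ∀ n, step S n ω = 1 ∨ step S n ω = -1 := by
  rw [ae_all_iff]
  intro n
  have hm : ∀ x : ℤ, MeasurableSet {ω | step S n ω = x} := fun x =>
    hS.measurable_step n (measurableSet_singleton x)
  have hdisj : Disjoint {ω | step S n ω = 1} {ω | step S n ω = -1} := by
    rw [Set.disjoint_left]
    intro ω h1 h2
    simp only [Set.mem_ofPred_eq] at h1 h2
    omega
  have h : μ.real ({ω | step S n ω = 1} ∪ {ω | step S n ω = -1}) = 1 := by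
    rw [measureReal_union hdisj (hm _), hS.prob_right, hS.prob_left]
    ring
  have h' : μ ({ω | step S n ω = 1} ∪ {ω | step S n ω = -1}) = 1 := by
    rw [Measure.real, ENNReal.toReal_eq_one_iff] at h
    exact h
  rw [← prob_compl_eq_zero_iff ((hm _).union (hm _))] at h'
  exact h'

omit [IsProbabilityMeasure μ] in
/-- The first `n` positions of the walk are independent of the `n`-th step. -/
lemma indepFun_stopped_step (n : ℕ) (Φ : (ℕ → ℤ) → ℝ) :
    (fun ω => Φ fun k => S (min k n) ω) ⟂ᵢ[μ] step S n ∧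
      Measurable fun ω => Φ fun k => S (min k n) ω := by
  let pos : (Finset.range n → ℤ) → ℕ → ℤ := fun x k =>
    ∑ j ∈ Finset.range (min k n), if h : j ∈ Finset.range n then x ⟨j, h⟩ else 0
  have heq : (fun ω => Φ fun k => S (min k n) ω) =
      (fun x => Φ (pos x)) ∘ fun ω (i : Finset.range n) => step S i ω := by
    ext ω
    simp only [Function.comp_apply]
    congr 1
    ext k
    rw [step_sum (hS.zero ω)]
    refine Finset.sum_congr rfl fun j hj => ?_
    rw [dif_pos (Finset.range_mono (min_le_right k n) hj)]
  -- `ℤ^n` is countable and discrete, so no regularity of `Φ` is needed.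
  have hΦ : Measurable fun x : Finset.range n → ℤ => Φ (pos x) := .of_discrete
  have hind := hS.indep.indepFun_finset (Finset.range n) {n} (by simp) hS.measurable_step
  constructor
  · rw [heq]
    exact hind.comp hΦ (measurable_pi_apply (⟨n, by simp⟩ : ({n} : Finset ℕ)))
  · rw [heq]
    exact hΦ.comp (measurable_pi_lambda _ fun i => hS.measurable_step i)

omit [IsProbabilityMeasure μ] in
lemma killedExp_indepFun (d : ℕ) (u s : ℝ) (n : ℕ) :
    killedExp S d u s n ⟂ᵢ[μ] step S n ∧ Measurable (killedExp S d u s n) := by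
  classical
  have h := hS.indepFun_stopped_step n fun y =>
    if ∀ j ≤ n, y j ≠ d then s ^ n * u ^ (-(y n)) else 0
  have heq : (fun ω => (fun y : ℕ → ℤ => if ∀ j ≤ n, y j ≠ d then s ^ n * u ^ (-(y n)) else 0)
      fun k => S (min k n) ω) = killedExp S d u s n := by
    ext ω
    have hiff : (∀ j ≤ n, S (min j n) ω ≠ d) ↔ ∀ j ≤ n, S j ω ≠ d :=
      forall₂_congr fun j hj => by rw [min_eq_left hj]
    simp only [killedExp, hiff, min_self]
  rwa [heq] at h

lemma integral_zpow_neg_step (u : ℝ) (n : ℕ) :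
    ∫ ω, u ^ (-(step S n ω)) ∂μ = p * u⁻¹ + (1 - p) * u := by
  have hm : ∀ x : ℤ, MeasurableSet {ω | step S n ω = x} := fun x =>
    hS.measurable_step n (measurableSet_singleton x)
  have heq : (fun ω => u ^ (-(step S n ω))) =ᵐ[μ] fun ω =>
      {ω | step S n ω = 1}.indicator (fun _ => u⁻¹) ω +
        {ω | step S n ω = -1}.indicator (fun _ => u) ω := by
    filter_upwards [hS.ae_step] with ω hω
    rcases hω n with h | h <;> simp [h]
  rw [integral_congr_ae heq, integral_add ((integrable_const _).indicator (hm _))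
    ((integrable_const _).indicator (hm _)), integral_indicator_const _ (hm _),
    integral_indicator_const _ (hm _), hS.prob_right, hS.prob_left]
  simp

lemma integrable_zpow_neg_step (u : ℝ) (n : ℕ) :
    Integrable (fun ω => u ^ (-(step S n ω))) μ := by
  refine Integrable.of_bound ?_ (|u⁻¹| + |u|) ?_
  · exact ((Measurable.of_discrete (f := fun x : ℤ => u ^ (-x))).comp
      (hS.measurable_step n)).aestronglyMeasurable
  · filter_upwards [hS.ae_step] with ω hω
    rcases hω n with h | h <;> simp [h]

section

variable {d : ℕ} {u s : ℝ} (hd : 0 < d) (hu0 : 0 < u) (hu1 : u ≤ 1) (hs0 : 0 ≤ s) (hs1 : s ≤ 1)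
  (hus : s * (p * u⁻¹ + (1 - p) * u) = 1)

omit [IsProbabilityMeasure μ] in
lemma measurable_zpow_neg_step (u : ℝ) (n : ℕ) :
    Measurable (fun ω => u ^ (-(step S n ω))) :=
  (Measurable.of_discrete (f := fun x : ℤ => u ^ (-x))).comp (hS.measurable_step n)

-- The killed factor depends only on the first `n` steps, so the expectation factorises; `hus` makes
-- the mean of the other factor vanish. This replaces conditional expectations.
include hus in
lemma integral_increment (n : ℕ) :
    ∫ ω, killedExp S d u s n ω * (s * u ^ (-(step S n ω)) - 1) ∂μ = 0 := by
  obtain ⟨hi, hm⟩ := hS.killedExp_indepFun d u s n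
  have hg : Measurable fun x : ℤ => s * u ^ (-x) - 1 := .of_discrete
  have hi' : killedExp S d u s n ⟂ᵢ[μ] fun ω => s * u ^ (-(step S n ω)) - 1 :=
    hi.comp measurable_id hg
  rw [hi'.integral_fun_mul_eq_mul_integral hm.aestronglyMeasurable
    (hg.comp (hS.measurable_step n)).aestronglyMeasurable,
    integral_sub ((hS.integrable_zpow_neg_step u n).const_mul s) (integrable_const _),
    integral_const_mul, hS.integral_zpow_neg_step, hus]
  simp

omit [IsProbabilityMeasure μ] in
lemma measurable_stoppedExp (n : ℕ) : Measurable (stoppedExp S d u s n) := by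
  unfold stoppedExp
  refine measurable_const.add (Finset.measurable_fun_sum _ fun k _ => ?_)
  exact (hS.killedExp_indepFun d u s k).2.mul
    (((hS.measurable_zpow_neg_step u k).const_mul s).sub_const 1)

include hd hu0 hu1 hs0 hs1 hus in
lemma integral_stoppedExp (n : ℕ) : ∫ ω, stoppedExp S d u s n ω ∂μ = 1 := by
  have hint : ∀ k, Integrable
      (fun ω => killedExp S d u s k ω * (s * u ^ (-(step S k ω)) - 1)) μ := by
    intro k
    refine Integrable.of_bound ?_ ((u ^ d)⁻¹ * (u⁻¹ + 1)) ?_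
    · exact ((hS.killedExp_indepFun d u s k).2.mul
        (((hS.measurable_zpow_neg_step u k).const_mul s).sub_const 1)).aestronglyMeasurable
    · filter_upwards [hS.ae_step] with ω hω
      exact abs_increment_le hd (hS.zero ω) hω hu0 hu1 hs0 hs1 k
  simp only [stoppedExp]
  rw [integral_add (integrable_const _) (integrable_finsetSum _ fun k _ => hint k),
    integral_finsetSum _ fun k _ => hint k,
    Finset.sum_eq_zero fun k _ => hS.integral_increment hus k]
  simp

omit [IsProbabilityMeasure μ] in
lemma measurableSet_hitTime_ne_top (d : ℕ) : MeasurableSet {ω | hitTime S d ω ≠ ⊤} := by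
  have : {ω | hitTime S d ω ≠ ⊤} = ⋃ j, S j ⁻¹' {(d : ℤ)} := by
    ext ω
    simp [hitTime_eq_top_iff]
  rw [this]
  exact .iUnion fun j => hS.measurable j (measurableSet_singleton _)

omit [IsProbabilityMeasure μ] in
lemma measurable_hitTime_untopD (d : ℕ) : Measurable fun ω => (hitTime S d ω).untopD 0 := by
  have hcoe : ∀ n : ℕ, MeasurableSet {ω | hitTime S d ω = WithTop.some n} := by
    intro n
    have : {ω | hitTime S d ω = WithTop.some n} = S n ⁻¹' {(d : ℤ)} ∩ ⋂ j < n, S j ⁻¹' {(d : ℤ)}ᶜ := by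
      ext ω
      rw [Set.mem_ofPred_eq, hitTime_eq_coe_iff]
      simp
    rw [this]
    exact (hS.measurable n (measurableSet_singleton _)).inter
      (.iInter fun j => .iInter fun _ => hS.measurable j (measurableSet_singleton _).compl)
  refine measurable_to_countable' fun n => ?_
  -- The value `0` also collects the event `N_d = ⊤`, because of the default in `untopD`.
  by_cases hn : n = 0
  · have : (fun ω => (hitTime S d ω).untopD 0) ⁻¹' {n} =
        {ω | hitTime S d ω = WithTop.some n} ∪ {ω | hitTime S d ω ≠ ⊤}ᶜ := by
      ext ω
      cases h : hitTime S d ω <;> simp [h, hn]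
    rw [this]
    exact (hcoe n).union (hS.measurableSet_hitTime_ne_top d).compl
  · have : (fun ω => (hitTime S d ω).untopD 0) ⁻¹' {n} = {ω | hitTime S d ω = WithTop.some n} := by
      ext ω
      cases h : hitTime S d ω with
      | top => simp [h, Ne.symm hn]
      | coe a =>
        simp only [Set.mem_preimage, h, Set.mem_singleton_iff, Set.mem_ofPred_eq]
        exact WithTop.coe_inj.symm
    rw [this]
    exact hcoe n

include hd hu0 hu1 hs0 hus in
/-- The generating function of the hitting time of `d`, on the event that `d` is visited. -/
lemma integral_indicator_pow_hitTime (hs1 : s < 1) :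
    ∫ ω, {ω | hitTime S d ω ≠ ⊤}.indicator (fun ω => s ^ (hitTime S d ω).untopD 0) ω ∂μ =
      u ^ d := by
  have hlim := tendsto_integral_of_dominated_convergence (μ := μ)
    (F := fun n ω => stoppedExp S d u s n ω)
    (f := fun ω => {ω | hitTime S d ω ≠ ⊤}.indicator
        (fun ω => s ^ (hitTime S d ω).untopD 0 * (u ^ d)⁻¹) ω)
    (fun _ => (u ^ d)⁻¹) (fun n => (hS.measurable_stoppedExp n).aestronglyMeasurable)
    (integrable_const _)
    (fun n => by
      filter_upwards [hS.ae_step] with ω hω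
      exact abs_stoppedExp_le hd (hS.zero ω) hω hu0 hu1 hs0 hs1.le n)
    (by
      filter_upwards [hS.ae_step] with ω hω
      exact tendsto_stoppedExp hd (hS.zero ω) hω hu0 hu1 hs0 hs1)
  simp only [hS.integral_stoppedExp hd hu0 hu1 hs0 hs1.le hus] at hlim
  have h1 := tendsto_nhds_unique hlim tendsto_const_nhds
  have h2 : ∀ ω, {ω | hitTime S d ω ≠ ⊤}.indicator
        (fun ω => s ^ (hitTime S d ω).untopD 0 * (u ^ d)⁻¹) ω =
      {ω | hitTime S d ω ≠ ⊤}.indicator (fun ω => s ^ (hitTime S d ω).untopD 0) ω *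
        (u ^ d)⁻¹ := fun ω => by
    rw [Set.indicator_mul_const]
  simp only [h2] at h1
  rw [integral_mul_const] at h1
  have hud : u ^ d ≠ 0 := by positivity
  field_simp at h1
  exact h1

end

end IsSimpleRandomWalk

end WinRate

end
-- The weight `s(u)` and its integrals
noncomputable section

namespace WinRate

/-- The weight `s(u) = u / (p + q u²)`, for which `s(u)^n u^(-S_n)` is a martingale. -/
def weight (p q u : ℝ) : ℝ := u / (p + q * u ^ 2)

/-- The derivative of `weight p q`. -/
def weightDeriv (p q u : ℝ) : ℝ := (p - q * u ^ 2) / (p + q * u ^ 2) ^ 2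

section Weight

variable {p q : ℝ} (hp : 0 < p) (hq : 0 < q)
include hp hq

lemma hasDerivAt_weight (u : ℝ) : HasDerivAt (weight p q) (weightDeriv p q u) u := by
  have h := (hasDerivAt_id u).div ((((hasDerivAt_id u).pow 2).const_mul q).const_add p)
    (denom_pos hp hq u).ne'
  refine h.congr_deriv ?_
  have h' := (denom_pos hp hq u).ne'
  simp [weightDeriv]
  field_simp
  ring

lemma continuous_weight : Continuous (weight p q) :=
  continuous_iff_continuousAt.2 fun u => (hasDerivAt_weight hp hq u).continuousAt

lemma continuous_weightDeriv : Continuous (weightDeriv p q) :=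
  Continuous.div (by fun_prop) (by fun_prop) fun u => (pow_pos (denom_pos hp hq u) 2).ne'

lemma weight_mul_eq_one {u : ℝ} (hu : 0 < u) : weight p q u * (p * u⁻¹ + q * u) = 1 := by
  have h' := (denom_pos hp hq u).ne'
  rw [weight]
  field_simp

lemma weight_lt_one (hpq : p + q = 1) (hqp : q ≤ p) {u : ℝ} (hu0 : 0 < u) (hu1 : u < 1) :
    weight p q u < 1 := by
  rw [weight, div_lt_one (denom_pos hp hq u)]
  -- `p + q u² - u = (1 - u)(p - q u)` because `p + q = 1`.
  nlinarith [mul_pos (sub_pos.2 hu1) (show 0 < p - q * u by nlinarith)]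

lemma integral_weight_pow (hpq : p + q = 1) {n : ℕ} (hn : 0 < n) :
    ∫ u in (0 : ℝ)..1, weight p q u ^ (n - 1) * weightDeriv p q u = 1 / n := by
  have hn0 : (n : ℝ) ≠ 0 := by positivity
  have hcont : Continuous fun u => weight p q u ^ (n - 1) * weightDeriv p q u :=
    ((continuous_weight hp hq).pow _).mul (continuous_weightDeriv hp hq)
  rw [intervalIntegral.integral_eq_sub_of_hasDerivAt
    (f := fun u => weight p q u ^ n / n) (fun u _ => ?_) (hcont.intervalIntegrable _ _)]
  · simp [weight, hpq, hn.ne']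
  · refine (((hasDerivAt_weight hp hq u).pow n).div_const (n : ℝ)).congr_deriv ?_
    field_simp

/-- Split `p - q u² = 2p - (p + q u²)`. The integrand is `u^n s'/s`. -/
lemma integral_pow_mul_logDeriv {n : ℕ} (hn : 0 < n) :
    ∫ u in (0 : ℝ)..1, u ^ (n - 1) * ((p - q * u ^ 2) / (p + q * u ^ 2)) =
      2 * p * ratioIntegral p q (n - 1) - 1 / n := by
  have h1 := (continuous_ratio hp hq (n - 1)).intervalIntegrable (μ := volume) 0 1
  have h : (fun u : ℝ => u ^ (n - 1) * ((p - q * u ^ 2) / (p + q * u ^ 2))) =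
      fun u => 2 * p * (u ^ (n - 1) / (p + q * u ^ 2)) - u ^ (n - 1) := by
    ext u
    have := (denom_pos hp hq u).ne'
    field_simp
    ring
  rw [h, intervalIntegral.integral_sub (h1.const_mul _)
    ((continuous_pow _).intervalIntegrable _ _), intervalIntegral.integral_const_mul, integral_pow,
    ratioIntegral]
  rw [← Nat.cast_add_one, Nat.sub_add_cancel hn]
  simp [hn.ne']

end Weight

/-! ### Almost sure finiteness and the expected win rate -/

namespace IsSimpleRandomWalk

variable {Ω : Type*} [MeasurableSpace Ω] {μ : Measure Ω} [IsProbabilityMeasure μ] {p q : ℝ}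
  {S : ℕ → Ω → ℤ} (hS : IsSimpleRandomWalk μ p S) {d : ℕ} (hd : 0 < d)
  (hp : 0 < p) (hq : 0 < q) (hpq : p + q = 1) (hqp : q ≤ p)
include hS hd hp hq hpq hqp

-- Since `s(u) < 1`, the generating function gives `u^d ≤ P[N_d < ∞]`; let `u` increase to `1`.
open Filter Topology in
lemma ae_hitTime_ne_top : ∀ᵐ ω ∂μ, hitTime S d ω ≠ ⊤ := by
  have hm := hS.measurableSet_hitTime_ne_top d
  obtain rfl : q = 1 - p := by linarith
  have hle : ∀ u : ℝ, 0 < u → u < 1 → u ^ d ≤ μ.real {ω | hitTime S d ω ≠ ⊤} := by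
    intro u hu0 hu1
    have hs0 : 0 ≤ weight p (1 - p) u := div_nonneg hu0.le (denom_pos hp hq u).le
    have hs1 := weight_lt_one hp hq hpq hqp hu0 hu1
    rw [← hS.integral_indicator_pow_hitTime hd hu0 hu1.le hs0 (weight_mul_eq_one hp hq hu0) hs1,
      integral_indicator hm, ← mul_one (μ.real _)]
    have := norm_setIntegral_le_of_norm_le_const (μ := μ) (s := {ω | hitTime S d ω ≠ ⊤})
      (f := fun ω => weight p (1 - p) u ^ (hitTime S d ω).untopD 0) (C := 1)
      (measure_lt_top _ _) fun ω _ => by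
        rw [Real.norm_of_nonneg (by positivity)]
        exact pow_le_one₀ hs0 hs1.le
    rw [one_mul] at this
    rw [mul_one]
    exact (le_abs_self _).trans this
  have hlim : Tendsto (fun u : ℝ => u ^ d) (𝓝[<] 1) (𝓝 1) := by
    have : ContinuousAt (fun u : ℝ => u ^ d) 1 := (continuous_pow d).continuousAt
    simpa [ContinuousAt] using this.mono_left nhdsWithin_le_nhds
  have h1 : 1 ≤ μ.real {ω | hitTime S d ω ≠ ⊤} := by
    refine le_of_tendsto hlim ?_
    filter_upwards [Ioo_mem_nhdsLT (zero_lt_one' ℝ)] with u hu using hle u hu.1 hu.2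
  have h2 : μ.real {ω | hitTime S d ω ≠ ⊤} = 1 := le_antisymm measureReal_le_one h1
  rw [Measure.real, ENNReal.toReal_eq_one_iff, ← prob_compl_eq_zero_iff hm] at h2
  exact h2

lemma integral_pow_hitTime {u : ℝ} (hu0 : 0 < u) (hu1 : u < 1) :
    ∫ ω, weight p q u ^ (hitTime S d ω).untopD 0 ∂μ = u ^ d := by
  have hae := hS.ae_hitTime_ne_top hd hp hq hpq hqp
  obtain rfl : q = 1 - p := by linarith
  have hs0 : 0 ≤ weight p (1 - p) u := div_nonneg hu0.le (denom_pos hp hq u).le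
  rw [← hS.integral_indicator_pow_hitTime hd hu0 hu1.le hs0 (weight_mul_eq_one hp hq hu0)
    (weight_lt_one hp hq hpq hqp hu0 hu1)]
  refine integral_congr_ae ?_
  filter_upwards [hae] with ω hω
  rw [Set.indicator_of_mem (by exact hω)]

lemma ae_hitTime_eq : ∀ᵐ ω ∂μ, 0 < (hitTime S d ω).untopD 0 ∧
    S ((hitTime S d ω).untopD 0) ω = d := by
  filter_upwards [hS.ae_hitTime_ne_top hd hp hq hpq hqp] with ω hω
  obtain ⟨N, hN⟩ := WithTop.ne_top_iff_exists.1 hω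
  obtain ⟨h1, -⟩ := hitTime_eq_coe_iff.1 hN.symm
  rw [← hN, show (WithTop.some N).untopD 0 = N from rfl]
  refine ⟨Nat.pos_of_ne_zero ?_, h1⟩
  rintro rfl
  rw [hS.zero] at h1
  omega

/-- Insert `1/N = ∫₀¹ s^(N-1) s' du` and exchange the integrals. Fubini applies since `0 ≤ s ≤ 1`
and `s'` is bounded on `[0, 1]`. -/
lemma integral_inv_hitTime :
    ∫ ω, 1 / (((hitTime S d ω).untopD 0 : ℕ) : ℝ) ∂μ =
      2 * p * ratioIntegral p q (d - 1) - 1 / d := by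
  have hT := hS.measurable_hitTime_untopD d
  have hae := hS.ae_hitTime_eq hd hp hq hpq hqp
  have hcw := continuous_weight hp hq
  have hcw' := continuous_weightDeriv hp hq
  have hint : Integrable (Function.uncurry fun (u : ℝ) (ω : Ω) =>
      weight p q u ^ ((hitTime S d ω).untopD 0 - 1) * weightDeriv p q u)
      ((volume.restrict (Set.uIoc (0 : ℝ) 1)).prod μ) := by
    obtain ⟨C, hC⟩ := (isCompact_Icc (a := (0 : ℝ)) (b := 1)).exists_bound_of_continuousOn
      hcw'.continuousOn
    have : IsFiniteMeasure (volume.restrict (Set.uIoc (0 : ℝ) 1)) := by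
      rw [Set.uIoc_of_le zero_le_one]; infer_instance
    refine Integrable.of_bound ?_ C ?_
    · refine Measurable.aestronglyMeasurable ?_
      exact ((hcw.measurable.comp measurable_fst).pow
        ((hT.comp measurable_snd).sub_const 1)).mul (hcw'.measurable.comp measurable_fst)
    · have hmem : ∀ᵐ u ∂(volume.restrict (Set.uIoc (0 : ℝ) 1)), u ∈ Set.uIoc (0 : ℝ) 1 :=
        ae_restrict_mem measurableSet_uIoc
      filter_upwards [Measure.quasiMeasurePreserving_fst.ae hmem] with z hz
      rw [Set.uIoc_of_le zero_le_one] at hz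
      have hs0 : 0 ≤ weight p q z.1 := div_nonneg hz.1.le (denom_pos hp hq _).le
      have hs1 : weight p q z.1 ≤ 1 := by
        rcases hz.2.lt_or_eq with h | h
        · exact (weight_lt_one hp hq hpq hqp hz.1 h).le
        · simp [h, weight, hpq]
      have h1 := hC z.1 ⟨hz.1.le, hz.2⟩
      rw [Function.uncurry, norm_mul, norm_pow, Real.norm_of_nonneg hs0]
      calc _ ≤ 1 * ‖weightDeriv p q z.1‖ := by
            gcongr
            exact pow_le_one₀ hs0 hs1
        _ ≤ C := by rwa [one_mul]
  have hswap := intervalIntegral_integral_swap hint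
  have hleft : ∫ u in (0 : ℝ)..1, ∫ ω, weight p q u ^ ((hitTime S d ω).untopD 0 - 1) *
      weightDeriv p q u ∂μ =
      ∫ u in (0 : ℝ)..1, u ^ (d - 1) * ((p - q * u ^ 2) / (p + q * u ^ 2)) := by
    refine intervalIntegral.integral_congr_Ioo_of_le zero_le_one fun u hu => ?_
    have h1 := hS.integral_pow_hitTime hd hp hq hpq hqp hu.1 hu.2
    have hs0 : 0 < weight p q u := div_pos hu.1 (denom_pos hp hq _)
    have h2 : ∫ ω, weight p q u ^ ((hitTime S d ω).untopD 0 - 1) ∂μ =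
        u ^ d / weight p q u := by
      rw [← h1, ← integral_div]
      refine integral_congr_ae ?_
      filter_upwards [hae] with ω hω
      -- Truncated subtraction in the exponent is harmless because `N > 0` almost surely.
      rw [eq_div_iff hs0.ne', pow_sub_one_mul hω.1.ne']
    rw [integral_mul_const, h2, weight, weightDeriv]
    have hu0 := hu.1.ne'
    have := (denom_pos hp hq u).ne'
    rw [← Nat.sub_add_cancel (Nat.one_le_iff_ne_zero.2 hd.ne'), Nat.add_sub_cancel, pow_succ]
    field_simp
  have hright : ∫ ω, (∫ u in (0 : ℝ)..1, weight p q u ^ ((hitTime S d ω).untopD 0 - 1) *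
      weightDeriv p q u) ∂μ = ∫ ω, 1 / (((hitTime S d ω).untopD 0 : ℕ) : ℝ) ∂μ := by
    refine integral_congr_ae ?_
    filter_upwards [hae] with ω hω
    exact integral_weight_pow hp hq hpq hω.1
  rw [← hright, ← hswap, hleft, integral_pow_mul_logDeriv hp hq hd]

lemma winRate_ae_eq : winRate S d =ᵐ[μ]
    fun ω => 1 / 2 + d / 2 * (1 / (((hitTime S d ω).untopD 0 : ℕ) : ℝ)) := by
  filter_upwards [hS.ae_hitTime_eq hd hp hq hpq hqp, hS.ae_step] with ω h1 h2
  have h3 := eq_two_mul_wins_sub (hS.zero ω) h2 ((hitTime S d ω).untopD 0)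
  rw [h1.2] at h3
  have h4 : (d : ℝ) = 2 * (wins S ((hitTime S d ω).untopD 0) ω : ℝ) -
      (((hitTime S d ω).untopD 0 : ℕ) : ℝ) := by exact_mod_cast h3
  have h5 : (((hitTime S d ω).untopD 0 : ℕ) : ℝ) ≠ 0 := by exact_mod_cast h1.1.ne'
  rw [winRate, h4]
  field_simp
  ring

lemma integrable_inv_hitTime :
    Integrable (fun ω => 1 / (((hitTime S d ω).untopD 0 : ℕ) : ℝ)) μ := by
  refine Integrable.of_bound ?_ 1 ?_
  · exact ((Measurable.of_discrete (f := fun n : ℕ => 1 / (n : ℝ))).comp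
      (hS.measurable_hitTime_untopD d)).aestronglyMeasurable
  · filter_upwards [hS.ae_hitTime_eq hd hp hq hpq hqp] with ω hω
    rw [Real.norm_of_nonneg (by positivity)]
    exact div_le_one_of_le₀ (by exact_mod_cast hω.1) (by positivity)

lemma integrable_winRate : Integrable (winRate S d) μ :=
  ((integrable_const _).add
    ((hS.integrable_inv_hitTime hd hp hq hpq hqp).const_mul _)).congr (hS.winRate_ae_eq hd hp hq hpq hqp).symm

lemma integral_winRate :
    ∫ ω, winRate S d ω ∂μ = d * p * ratioIntegral p q (d - 1) := by
  rw [integral_congr_ae (hS.winRate_ae_eq hd hp hq hpq hqp),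
    integral_add (integrable_const _)
      ((hS.integrable_inv_hitTime hd hp hq hpq hqp).const_mul _),
    integral_const_mul, hS.integral_inv_hitTime hd hp hq hpq hqp]
  have : (d : ℝ) ≠ 0 := by positivity
  simp
  field_simp
  ring

end IsSimpleRandomWalk

end WinRate

end

theorem theorem2 {Ω : Type*} [MeasurableSpace Ω] (μ : Measure Ω) [IsProbabilityMeasure μ]
    (p q : ℝ) (hp : 1 / 2 ≤ p) (hp1 : p < 1) (hq : q = 1 - p)
    (S : ℕ → Ω → ℤ) (hS : WinRate.IsSimpleRandomWalk μ p S)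
    (d : ℕ) (hd : 0 < d) :
    (∀ᵐ ω ∂μ, WinRate.hitTime S d ω ≠ ⊤) ∧
    Integrable (WinRate.winRate S d) μ ∧
    (Odd d →
      ∫ ω, WinRate.winRate S d ω ∂μ =
        (-1) ^ ((d - 1) / 2) * d * (p / q) ^ ((d : ℝ) / 2) * Real.arctan (Real.sqrt (q / p))
          + 1
          - d * ∑ k ∈ Finset.range ((d - 1) / 2 + 1),
              (-1) ^ k / ((d : ℝ) - 2 * k) * (p / q) ^ k) ∧
    (Even d →
      ∫ ω, WinRate.winRate S d ω ∂μ =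
        (-1) ^ (d / 2) * ((d : ℝ) / 2) * (p / q) ^ (d / 2) * Real.log p
          + 1
          - (d : ℝ) / 2 * (p / q) ^ (d / 2) *
            ∑ k ∈ Finset.Icc 1 (d / 2),
              (-1) ^ (d / 2 + k) * ((d / 2).choose k : ℝ) * (((p ^ k)⁻¹ - 1) / k)) ∧
    (p = 1 / 2 → d = 1 → ∫ ω, WinRate.winRate S d ω ∂μ = Real.pi / 4) ∧
    (p = 1 / 2 → d = 2 → ∫ ω, WinRate.winRate S d ω ∂μ = Real.log 2) ∧
    (p = 1 / 2 → d = 3 → ∫ ω, WinRate.winRate S d ω ∂μ = 3 * (1 - Real.pi / 4)) := by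
  have hq0 : 0 < q := by linarith
  have hp0 : 0 < p := by linarith
  have hpq : p + q = 1 := by linarith
  have hqp : q ≤ p := by linarith
  have hodd : Odd d → _ := fun h => (hS.integral_winRate hd hp0 hq0 hpq hqp).trans
    (WinRate.odd_formula hp0 hq0 h)
  have heven : Even d → _ := fun h => (hS.integral_winRate hd hp0 hq0 hpq hqp).trans
    (WinRate.even_formula hp0 hq0 hpq hd h)
  refine ⟨hS.ae_hitTime_ne_top hd hp0 hq0 hpq hqp, hS.integrable_winRate hd hp0 hq0 hpq hqp,
    hodd, heven, ?_, ?_, ?_⟩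
  · rintro rfl rfl
    rw [hodd (by decide), show q = 1 / 2 by linarith]
    norm_num
  · rintro rfl rfl
    rw [heven (by decide), show q = 1 / 2 by linarith, one_div, Real.log_inv]
    norm_num
  · rintro rfl rfl
    rw [hodd (by decide), show q = 1 / 2 by linarith]
    norm_num [Finset.sum_range_succ]
    ring
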